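/- **Model.** There are two resource types with fares $0\le r_1<r_2$, initial availabilities $c_1,c_2\in\mathbb N$, and $T$ periods. Independently in each period a type-$i$ request arrives with probability $\lambda_i$ ($i=1,2$), and no request arrives with probability $\lambda_0=1-\lambda_1-\lambda_2\ge 0$. A type-1 requester who is offered an upgrade to type 2 at an additional price $u\in[0,r_2-r_1]$ accepts it, independently of everything else, with probability $f(u)$. Here $f$ is continuous and strictly decreasing on $[0,r_2-r_1]$ with $f(0)=1$ and $f\ge 0$; its inverse is $p$ (continued by $p(v)=r_2-r_1$ for $v<f(r_2-r_1)$ and by $p(v)=0$ for $v>1$), and $R(v)=v\,p(v)$ is quasi-concave on $[0,1]$ with a maximizer $v^\star\in[f(r_2-r_1),1]$. **Policy DynUp-2.** Let $c_i^{(t)}$ be the availability of resource $i$ at the start of period $t$ and $n=T-t+1$. A type-2 request is accepted if and only if $c_2^{(t)}\ge 1$, for revenue $r_2$. A type-1 request with $c_1^{(t)}\ge1$ is accepted. If moreover $c_2^{(t)}\ge 1$, it is offered an upgrade at price $\min\{\max\{p(v),0\},1\}$, where $$v=\min\Big\{\max\Big\{\tfrac{c_2^{(t)}-\lambda_2n}{c_1^{(t)}+c_2^{(t)}-\lambda_2n},0\Big\},1\Big\}\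 \text{ if } c_1^{(t)}+c_2^{(t)}<(\lambda_1+\lambda_2)n,$$ $$v=\max\Big\{\min\Big\{v^\star,\tfrac{c_2^{(t)}}{\lambda_1n}-\tfrac{\lambda_2}{\lambda_1}\Big\},1-\tfrac{c_1^{(t)}}{\lambda_1n}\Big\}\ \text{ otherwise.}$$ It pays $r_1$ plus the price and uses a type-2 unit if it takes the upgrade; otherwise it pays $r_1$ and uses a type-1 unit. A type-1 request with $c_1^{(t)}=0$ is accepted, with a free upgrade and for revenue $r_1$, if and only if $(c_2^{(t)}-\lambda_2n)^+>\frac12\lambda_1n$. Let $\tau$ be the first period $t\le T$ with $c_1^{(t)}=0$ (if there is none, $\tau=T+1$ and the segment $[\tau,T]$ is empty). Let $W^\pi(\tau,T)$ be the revenue of DynUp-2 in the periods $\tau,\dots,T$. **Benchmark.** For availabilities $c_1,c_2$ and arrival counts $\Lambda_1,\Lambda_2$ put $s(v)=\min\{\Lambda_1,\frac{(c_2-\Lambda_2)^+}{v},\frac{c_1}{1-v}\}$, where $y/0=\infty$ for $y>0$ and $0/0=0$. Let $w^{U}$ be the supremum over $v\in[0,1]$ of $$r_2\min\{\Lambda_2,c_2\}+\Lambda_1(R(v)+r_1)\quad\text{over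 those } v \text{ with } s(v)=\Lambda_1,$$ $$r_2\min\{\Lambda_2,c_2\}+s(v)R(v)+r_1\min\{\Lambda_1,c_1+(c_2-\Lambda_2)^+\}\quad\text{over those } v \text{ with } s(v)=\tfrac{(c_2-\Lambda_2)^+}{v}\text{ or } s(v)=\tfrac{c_1}{1-v}.$$ Let $W^U(\tau,T)$ be $w^U$ evaluated at the availabilities $c_1^{(\tau)},c_2^{(\tau)}$ and at the numbers $\Lambda_1,\Lambda_2$ of type-1 and type-2 arrivals in $[\tau,T]$. **Proposition.** 1. On every sample path, DynUp-2 on $[\tau,T]$ runs a single-leg quantity-based revenue management problem: for $\tau\le t\le T$ we have $c_1^{(t)}=0$, and the request in period $t$ is either accepted, using one unit of the type-2 resource and paying exactly its fare $r_1$ or $r_2$, or rejected. 2. On every sample path, $W^U(\tau,T)$ is the hindsight optimum of that single-leg problem, namely $$\max\{r_1y_1+r_2y_2:\ y_i\in\mathbb N,\ y_i\le\Lambda_i,\ y_1+y_2\le c_2^{(\tau)}\}.$$ 3. There is a constant $K$ depending only on $r_1,r_2,\lambda_1,\lambda_2$ (not on $T,c_1,c_2,f$) such that $W^{U}(\tau,T)-W^\pi(\tau,T)$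 is integrable and $|\mathbb E[W^{U}(\tau,T)-W^{\pi}(\tau,T)]|\le K$. -/

import Mathlib

open MeasureTheory ProbabilityTheory
open scoped ENNReal

noncomputable section

namespace Upgrading

/-- Fares `r₁ < r₂` and arrival rates `λ₁, λ₂` of the two request types.  In every period a type-`i`
request arrives with probability `λᵢ`; no request arrives with probability `λ₀ = 1 - λ₁ - λ₂`. -/
structure Market where
  r1 : ℝ
  r2 : ℝ
  l1 : ℝ
  l2 : ℝ
  r1_nonneg : 0 ≤ r1
  r1_lt_r2 : r1 < r2
  l1_nonneg : 0 ≤ l1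
  l2_nonneg : 0 ≤ l2
  rates_le_one : l1 + l2 ≤ 1

namespace Market

/-- Arrival probabilities; the value `0 : Fin 3` stands for "no request". -/
def rate (M : Market) : Fin 3 → ℝ := ![1 - M.l1 - M.l2, M.l1, M.l2]

/-- Fare of a request of each type (`0` for "no request"). -/
def fare (M : Market) : Fin 3 → ℝ := ![0, M.r1, M.r2]

/-- The largest admissible upgrade price `r₂ - r₁`. -/
def maxPrice (M : Market) : ℝ := M.r2 - M.r1

end Market

/-- The inverse `p` of an acceptance probability `f` which is continuous and strictly decreasing on
the admissible prices `[0, d]`, with `f 0 = 1`.  For `v ∈ [f d, 1]`, `inversePrice d f v` is the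
unique `u ∈ [0, d]` with `f u = v`; it is continued by `d` below `f d` and by `0` above `1`. -/
def inversePrice (d : ℝ) (f : ℝ → ℝ) (v : ℝ) : ℝ :=
  sSup {u : ℝ | u ∈ Set.Icc 0 d ∧ v ≤ f u}

/-- The probability `f u` that a type-1 requester accepts an upgrade at the additional price `u`,
with a maximizer `vstar` of the upgrade revenue `R(v) = v p(v)`. -/
structure UpgradeCurve (M : Market) where
  f : ℝ → ℝ
  vstar : ℝ
  continuousOn : ContinuousOn f (Set.Icc 0 M.maxPrice)
  strictAntiOn : StrictAntiOn f (Set.Icc 0 M.maxPrice)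
  f_zero : f 0 = 1
  f_nonneg : 0 ≤ f M.maxPrice
  quasiconcaveOn : QuasiconcaveOn ℝ (Set.Icc 0 1) (fun v => v * inversePrice M.maxPrice f v)
  vstar_mem : vstar ∈ Set.Icc (f M.maxPrice) 1
  vstar_isMax : IsMaxOn (fun v => v * inversePrice M.maxPrice f v) (Set.Icc 0 1) vstar

variable {M : Market}

namespace UpgradeCurve

/-- The price `p(v)` at which an upgrade is accepted with probability `v`. -/
def p (F : UpgradeCurve M) (v : ℝ) : ℝ := inversePrice M.maxPrice F.f v

/-- The expected revenue `R(v) = v p(v)` from offering an upgrade. -/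
def R (F : UpgradeCurve M) (v : ℝ) : ℝ := v * F.p v

end UpgradeCurve

/-! ### The policy DynUp-2 -/

/-- The number `T - t + 1` of periods from `t` to `T`, as a real number. -/
def periodsLeft (T t : ℕ) : ℝ := (T : ℝ) - (t : ℝ) + 1

/-- The target upgrade probability in period `t`, from the remaining availabilities `c1`, `c2`. -/
def upgradeProb (F : UpgradeCurve M) (T t c1 c2 : ℕ) : ℝ :=
  let n := periodsLeft T t
  if (c1 : ℝ) + c2 < (M.l1 + M.l2) * n then
    min (max (((c2 : ℝ) - M.l2 * n) / ((c1 : ℝ) + c2 - M.l2 * n)) 0) 1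
  else
    max (min F.vstar ((c2 : ℝ) / (M.l1 * n) - M.l2 / M.l1)) (1 - (c1 : ℝ) / (M.l1 * n))

/-- The upgrade price offered in period `t`. -/
def upgradePrice (F : UpgradeCurve M) (T t c1 c2 : ℕ) : ℝ :=
  min (max (F.p (upgradeProb F T t c1 c2)) 0) 1

/-- One period of DynUp-2 with remaining availabilities `c = (c1, c2)`, arrival `a` and the
requester's uniform mark `x` (an upgrade offered at price `u` is accepted iff `x ≤ f u`).
Returns the revenue of the period and the availabilities after it. -/
def step (F : UpgradeCurve M) (T t : ℕ) (c : ℕ × ℕ) (a : Fin 3) (x : ℝ) : ℝ × (ℕ × ℕ) :=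
  if a = 2 then
    if 1 ≤ c.2 then (M.r2, (c.1, c.2 - 1)) else (0, c)
  else if a = 1 then
    if 1 ≤ c.1 then
      if 1 ≤ c.2 then
        if x ≤ F.f (upgradePrice F T t c.1 c.2) then
          (M.r1 + upgradePrice F T t c.1 c.2, (c.1, c.2 - 1))
        else (M.r1, (c.1 - 1, c.2))
      else (M.r1, (c.1 - 1, c.2))
    else if 1 / 2 * M.l1 * periodsLeft T t < max ((c.2 : ℝ) - M.l2 * periodsLeft T t) 0 then
      -- accepted with a free upgrade
      (M.r1, (c.1, c.2 - 1))
    else (0, c)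
  else (0, c)

/-- Availabilities after `k` periods, from `c` and along the sample path `a`, `x`. -/
def availAfter (F : UpgradeCurve M) (T : ℕ) (c : ℕ × ℕ) (a : ℕ → Fin 3) (x : ℕ → ℝ) :
    ℕ → ℕ × ℕ
  | 0 => c
  | k + 1 => (step F T (k + 1) (availAfter F T c a x k) (a (k + 1)) (x (k + 1))).2

/-- Availabilities `(c₁⁽ᵗ⁾, c₂⁽ᵗ⁾)` at the start of period `t ≥ 1`. -/
def avail (F : UpgradeCurve M) (T : ℕ) (c : ℕ × ℕ) (a : ℕ → Fin 3) (x : ℕ → ℝ) (t : ℕ) : ℕ × ℕ :=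
  availAfter F T c a x (t - 1)

/-- Revenue of DynUp-2 in period `t ≥ 1`. -/
def revenue (F : UpgradeCurve M) (T : ℕ) (c : ℕ × ℕ) (a : ℕ → Fin 3) (x : ℕ → ℝ) (t : ℕ) : ℝ :=
  (step F T t (avail F T c a x t) (a t) (x t)).1

/-- Revenue `W^π(s, e)` of DynUp-2 in the periods `s, …, e`. -/
def policyRevenue (F : UpgradeCurve M) (T : ℕ) (c : ℕ × ℕ) (a : ℕ → Fin 3) (x : ℕ → ℝ)
    (s e : ℕ) : ℝ :=
  ∑ t ∈ Finset.Icc s e, revenue F T c a x t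

/-- The first period `τ ≤ T` at whose start no type-1 resource is left; `T + 1` if there is none,
in which case the segment `[τ, T]` is empty. -/
def tau (F : UpgradeCurve M) (T : ℕ) (c : ℕ × ℕ) (a : ℕ → Fin 3) (x : ℕ → ℝ) : ℕ :=
  sInf ({t : ℕ | 1 ≤ t ∧ t ≤ T ∧ (avail F T c a x t).1 = 0} ∪ {T + 1})

/-! ### The benchmark -/

/-- Number of type-`i` arrivals in the periods `s, …, e`. -/
def arrivals (a : ℕ → Fin 3) (i : Fin 3) (s e : ℕ) : ℕ :=
  ((Finset.Icc s e).filter (fun t => a t = i)).card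

/-- `min {Λ₁, (c₂ - Λ₂)⁺ / v, c₁ / (1 - v)}`: the number of type-1 requests that can be served with
upgrade probability `v` until one of the resources is used up (`y / 0 = ∞` for `y ≠ 0`).
The subtraction of natural numbers is truncated. -/
def servable (c1 c2 L1 L2 : ℕ) (v : ℝ) : ℝ≥0∞ :=
  min (L1 : ℝ≥0∞)
    (min (((c2 - L2 : ℕ) : ℝ≥0∞) / ENNReal.ofReal v) ((c1 : ℝ≥0∞) / ENNReal.ofReal (1 - v)))

/-- The hybrid upper bound `w^U = max {w^{U₁}, w^{U₂}, w^{U₃}}` on the revenue with availabilities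
`c1`, `c2` and `L1`, `L2` arrivals: `min {Λ₂, c₂}` type-2 requests are served, and the
upgrade probability `v` is chosen optimally.  The three sets are the cases in which no resource, the
type-2 resource, or the type-1 resource is used up first. -/
def upperHP (F : UpgradeCurve M) (c1 c2 L1 L2 : ℕ) : ℝ :=
  sSup ({w : ℝ | ∃ v ∈ Set.Icc (0 : ℝ) 1, servable c1 c2 L1 L2 v = L1 ∧
          w = M.r2 * (min L2 c2 : ℕ) + L1 * (F.R v + M.r1)} ∪
        {w : ℝ | ∃ v ∈ Set.Icc (0 : ℝ) 1,
          servable c1 c2 L1 L2 v = ((c2 - L2 : ℕ) : ℝ≥0∞) / ENNReal.ofReal v ∧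
          w = M.r2 * (min L2 c2 : ℕ) + (servable c1 c2 L1 L2 v).toReal * F.R v
            + M.r1 * (min L1 (c1 + (c2 - L2)) : ℕ)} ∪
        {w : ℝ | ∃ v ∈ Set.Icc (0 : ℝ) 1,
          servable c1 c2 L1 L2 v = (c1 : ℝ≥0∞) / ENNReal.ofReal (1 - v) ∧
          w = M.r2 * (min L2 c2 : ℕ) + (servable c1 c2 L1 L2 v).toReal * F.R v
            + M.r1 * (min L1 (c1 + (c2 - L2)) : ℕ)})

/-- The upper bound `W^U(s, T)` for the periods `s, …, T`, started from the availabilities which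
DynUp-2 leaves at the start of period `s`. -/
def upperRevenue (F : UpgradeCurve M) (T : ℕ) (c : ℕ × ℕ) (a : ℕ → Fin 3) (x : ℕ → ℝ)
    (s : ℕ) : ℝ :=
  upperHP F (avail F T c a x s).1 (avail F T c a x s).2 (arrivals a 1 s T) (arrivals a 2 s T)

/-- `W^U(τ, T) - W^π(τ, T)` along a sample path. -/
def tauRegret (F : UpgradeCurve M) (T : ℕ) (c : ℕ × ℕ) (a : ℕ → Fin 3) (x : ℕ → ℝ) : ℝ :=
  upperRevenue F T c a x (tau F T c a x) - policyRevenue F T c a x (tau F T c a x) T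

/-- Revenues attainable in hindsight in single-leg quantity-based revenue management with capacity
`C`, fares `r₁`, `r₂` and `L1`, `L2` arrivals: accept `yᵢ ≤ Lᵢ` requests, `y₁ + y₂ ≤ C`. -/
def singleLegRevenues (M : Market) (C L1 L2 : ℕ) : Set ℝ :=
  {w : ℝ | ∃ y1 y2 : ℕ, y1 ≤ L1 ∧ y2 ≤ L2 ∧ y1 + y2 ≤ C ∧ w = M.r1 * y1 + M.r2 * y2}

/-! ### Randomness -/

/-- Arrivals `A t` with law `(λ₀, λ₁, λ₂)` and uniform marks `U t`, all independent. -/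
structure IsRequestProcess (M : Market) {Ω : Type*} [MeasurableSpace Ω] (P : Measure Ω)
    (A : ℕ → Ω → Fin 3) (U : ℕ → Ω → ℝ) : Prop where
  measurable_A : ∀ t, Measurable (A t)
  measurable_U : ∀ t, Measurable (U t)
  law_A : ∀ t i, P {ω | A t ω = i} = ENNReal.ofReal (M.rate i)
  law_U : ∀ t, P.map (U t) = volume.restrict (Set.Icc (0 : ℝ) 1)
  indep_mark : ∀ t, IndepFun (A t) (U t) P
  indep_periods : iIndepFun (fun t ω => (A t ω, U t ω)) P

end Upgrading

end

namespace Upgrading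

variable {M : Market}

/-! ### The single-leg hindsight optimum -/

/-! From `τ` on there are no type-1 units, so every sale uses a type-2 unit at the plain fare, and
in `upperHP` the upgrade term vanishes: the benchmark collapses to the greedy single-leg optimum
`hindsight`. The regret is then a telescoping sum of one-period losses, each the drop in `hindsight`
not covered by the period's revenue (`hindsight_sub_step_mem`). A loss lies in `[0, r₂]` and is
nonzero only if a type-1 decision proves wrong. The acceptance threshold lies halfway between the
expected type-2 demand and the expected total demand, so a wrong decision with `m` periods to go
forces the later arrivals of type 2 or type 0 to deviate from their mean by order `λ₁ m / 2`
(`Misjudged`). By Hoeffding's lemma this has probability geometrically small in `m`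
(`measureReal_misjudged_le`), and the geometric series is bounded independently of `T`. The pathwise
bound is summed over all periods, so no conditioning on the random `τ` is needed. -/

/-- The hindsight optimum of the single-leg problem with capacity `C` and `L1`, `L2` arrivals. -/
def hindsight (M : Market) (C L1 L2 : ℕ) : ℝ :=
  M.r2 * (min L2 C : ℕ) + M.r1 * (min L1 (C - L2) : ℕ)

/-- Serving type 2 first maximizes both `y2` and `y1 + y2`, and the revenue is `r₁ (y1 + y2) + (r₂ -
r₁) y2` with nonnegative coefficients. -/
lemma isGreatest_hindsight (M : Market) (C L1 L2 : ℕ) :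
    IsGreatest (singleLegRevenues M C L1 L2) (hindsight M C L1 L2) := by
  have h1 := M.r1_nonneg
  have h2 := M.r1_lt_r2
  constructor
  · exact ⟨min L1 (C - L2), min L2 C, by omega, by omega, by omega, by
      unfold hindsight; ring⟩
  · rintro w ⟨y1, y2, hy1, hy2, hy, rfl⟩
    unfold hindsight
    have ha : (y2 : ℝ) ≤ (min L2 C : ℕ) := by exact_mod_cast (show y2 ≤ min L2 C by omega)
    have hb : (y1 : ℝ) + y2 ≤ (min L2 C : ℕ) + (min L1 (C - L2) : ℕ) := by
      exact_mod_cast (show y1 + y2 ≤ min L2 C + min L1 (C - L2) by omega)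
    nlinarith [mul_nonneg (sub_nonneg.2 h2.le) (sub_nonneg.2 ha),
      mul_nonneg h1 (sub_nonneg.2 hb)]

/-- With nothing servable, every element of the three sets has the same value, and `v` no longer
matters. The hypothesis `hne` supplies an element, in the first set if `L1 = 0` and in the third if
`c1 = 0`. -/
lemma upperHP_of_servable_eq_zero (F : UpgradeCurve M) (c1 c2 L1 L2 : ℕ)
    (h : ∀ v, servable c1 c2 L1 L2 v = 0)
    (hmin : min L1 (c1 + (c2 - L2)) = min L1 (c2 - L2))
    (hne : L1 = 0 ∨ c1 = 0) :
    upperHP F c1 c2 L1 L2 = hindsight M c2 L1 L2 := by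
  unfold upperHP
  refine csSup_eq_of_forall_le_of_forall_lt_exists_gt ?_ ?_ ?_
  · rcases hne with rfl | rfl
    · exact ⟨_, Or.inl (Or.inl ⟨0, by simp, by simpa using h 0, rfl⟩)⟩
    · exact ⟨_, Or.inr ⟨0, by simp, by simpa using h 0, rfl⟩⟩
  · rintro w ((⟨v, -, hv, rfl⟩ | ⟨v, -, -, rfl⟩) | ⟨v, -, -, rfl⟩)
    -- Membership in the first set requires that all of `L1` be servable, which forces `L1 = 0`.
    · have : L1 = 0 := by simpa [h v] using hv.symm
      subst this
      simp [hindsight]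
    · simp [h v, hmin, hindsight]
    · simp [h v, hmin, hindsight]
  · intro w hw
    refine ⟨hindsight M c2 L1 L2, ?_, hw⟩
    rcases hne with rfl | rfl
    · exact Or.inl (Or.inl ⟨0, by simp, by simpa using h 0, by simp [hindsight]⟩)
    · exact Or.inr ⟨0, by simp, by simpa using h 0, by simp [hindsight, h 0]⟩

lemma upperHP_zero_left (F : UpgradeCurve M) (c2 L1 L2 : ℕ) :
    upperHP F 0 c2 L1 L2 = hindsight M c2 L1 L2 :=
  upperHP_of_servable_eq_zero F 0 c2 L1 L2 (fun v => by simp [servable]) (by simp) (Or.inr rfl)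

/-- Needed for `τ = T + 1`: the segment is empty, but type-1 units may remain. -/
lemma upperHP_of_no_arrivals (F : UpgradeCurve M) (c1 c2 L2 : ℕ) :
    upperHP F c1 c2 0 L2 = hindsight M c2 0 L2 :=
  upperHP_of_servable_eq_zero F c1 c2 0 L2 (fun v => by simp [servable]) (by simp) (Or.inl rfl)

/-! ### The segment from `τ` on -/

section Path

variable (F : UpgradeCurve M) (T : ℕ) (c : ℕ × ℕ) (a : ℕ → Fin 3) (x : ℕ → ℝ)

lemma avail_succ {t : ℕ} (ht : 1 ≤ t) :
    avail F T c a x (t + 1) = (step F T t (avail F T c a x t) (a t) (x t)).2 := by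
  obtain ⟨k, rfl⟩ := Nat.exists_eq_add_of_le' ht
  simp [avail, availAfter]

lemma tau_mem : tau F T c a x ∈
    {t : ℕ | 1 ≤ t ∧ t ≤ T ∧ (avail F T c a x t).1 = 0} ∪ {T + 1} :=
  Nat.sInf_mem ⟨T + 1, by simp⟩

lemma one_le_tau : 1 ≤ tau F T c a x := by
  rcases tau_mem F T c a x with h | h
  · exact h.1
  · have : tau F T c a x = T + 1 := h
    omega

lemma tau_le : tau F T c a x ≤ T + 1 := by
  rcases tau_mem F T c a x with h | h
  · have := h.2.1
    omega
  · exact le_of_eq h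

lemma one_le_periodsLeft {t : ℕ} (ht : t ≤ T) : 1 ≤ periodsLeft T t := by
  have : (t : ℝ) ≤ T := by exact_mod_cast ht
  unfold periodsLeft
  linarith

/-- Free upgrades are only granted while type-2 units are left. -/
lemma one_le_of_free_upgrade {t C : ℕ} (ht : t ≤ T)
    (h : 1 / 2 * M.l1 * periodsLeft T t < max ((C : ℝ) - M.l2 * periodsLeft T t) 0) : 1 ≤ C := by
  have hn := one_le_periodsLeft T ht
  have h0 : 0 ≤ 1 / 2 * M.l1 * periodsLeft T t := by
    have := M.l1_nonneg
    positivity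
  rcases lt_max_iff.1 h with h | h
  · have := mul_nonneg M.l2_nonneg (zero_le_one.trans hn)
    have : (0 : ℝ) < C := by linarith
    exact_mod_cast this
  · linarith

lemma exists_step_of_fst_eq_zero {t C : ℕ} (ht : t ≤ T) (b : Fin 3) (u : ℝ) :
    ∃ y : ℕ, y ≤ (if b = 0 then 0 else 1) ∧ y ≤ C ∧
      (step F T t (0, C) b u).1 = y * M.fare b ∧ (step F T t (0, C) b u).2 = (0, C - y) := by
  fin_cases b
  · exact ⟨0, by simp [step]⟩
  · by_cases h : 1 / 2 * M.l1 * periodsLeft T t < max ((C : ℝ) - M.l2 * periodsLeft T t) 0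
    · refine ⟨1, by simp, one_le_of_free_upgrade T ht h, ?_⟩
      simp only [step]
      simp [h, Market.fare, -one_div]
    · refine ⟨0, by simp, by simp, ?_⟩
      simp only [step]
      simp [h, -one_div]
  · by_cases h : 1 ≤ C
    · exact ⟨1, by simp, h, by simp [step, h, Market.fare]⟩
    · exact ⟨0, by simp, by simp, by simp [step, h]⟩

lemma avail_fst_eq_zero_of_tau_le {t : ℕ} (h1 : tau F T c a x ≤ t) (h2 : t ≤ T) :
    (avail F T c a x t).1 = 0 := by
  induction t, h1 using Nat.le_induction with
  | base =>
    rcases tau_mem F T c a x with h | h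
    · exact h.2.2
    · have : tau F T c a x = T + 1 := h
      omega
  | succ t h1 ih =>
    have ht := (one_le_tau F T c a x).trans h1
    have h0 := ih (by omega)
    obtain ⟨y, -, -, -, hy⟩ := exists_step_of_fst_eq_zero F T (t := t)
      (C := (avail F T c a x t).2) (by omega) (a t) (x t)
    rw [← h0] at hy
    rw [avail_succ F T c a x ht, hy, h0]

lemma arrivals_eq_zero_of_lt (i : Fin 3) {s e : ℕ} (h : e < s) : arrivals a i s e = 0 := by
  simp [arrivals, Finset.Icc_eq_empty (not_le.2 h)]

lemma arrivals_eq_add (i : Fin 3) {s e : ℕ} (h : s ≤ e) :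
    arrivals a i s e = (if a s = i then 1 else 0) + arrivals a i (s + 1) e := by
  have : Finset.Icc s e = insert s (Finset.Icc (s + 1) e) := by
    ext k
    simp only [Finset.mem_Icc, Finset.mem_insert]
    omega
  rw [arrivals, arrivals, this, Finset.filter_insert]
  split_ifs
  · rw [Finset.card_insert_of_notMem (by simp)]
    omega
  · omega

/-- Turns a shortage of type-1 and type-2 arrivals into an excess of periods without a request. -/
lemma arrivals_add_add {s e : ℕ} :
    arrivals a 0 s e + arrivals a 1 s e + arrivals a 2 s e = e + 1 - s := by
  rw [← Nat.card_Icc]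
  simp only [arrivals, Finset.card_filter, ← Finset.sum_add_distrib]
  rw [Finset.card_eq_sum_ones]
  refine Finset.sum_congr rfl fun t _ => ?_
  generalize a t = b
  fin_cases b <;> rfl

lemma upperRevenue_tau : upperRevenue F T c a x (tau F T c a x) =
    hindsight M (avail F T c a x (tau F T c a x)).2 (arrivals a 1 (tau F T c a x) T)
      (arrivals a 2 (tau F T c a x) T) := by
  unfold upperRevenue
  by_cases h : tau F T c a x ≤ T
  · rw [avail_fst_eq_zero_of_tau_le F T c a x le_rfl h, upperHP_zero_left]
  · rw [arrivals_eq_zero_of_lt a 1 (not_le.1 h), upperHP_of_no_arrivals]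

/-! ### The loss of a single decision -/

/-- A type-1 request arrives in period `t`, and the type-0 or type-2 arrivals in the periods
`t + 1, …, T` exceed their mean by at least `λ₁ (T - t) / 2 - 1`. -/
def Misjudged (M : Market) (T : ℕ) (a : ℕ → Fin 3) (t : ℕ) : Prop :=
  a t = 1 ∧ ∃ i : Fin 3, (i = 0 ∨ i = 2) ∧
    M.l1 * ((T - t : ℕ) : ℝ) / 2 - 1 ≤
      (arrivals a i (t + 1) T : ℝ) - M.rate i * ((T - t : ℕ) : ℝ)

/-- Accepting type 2 is always optimal. Accepting type 1 costs `r₂ - r₁` if the later type-2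
requests alone exhaust `C`, and nothing otherwise; rejecting it costs `r₁` if a unit would be left
over at the end, and nothing otherwise. -/
lemma hindsight_sub_step_mem {t C : ℕ} (ht : t ≤ T) (u : ℝ) :
    hindsight M C (arrivals a 1 t T) (arrivals a 2 t T) - (step F T t (0, C) (a t) u).1 -
      hindsight M (step F T t (0, C) (a t) u).2.2 (arrivals a 1 (t + 1) T)
        (arrivals a 2 (t + 1) T) ∈
      Set.Icc 0 (Set.indicator {s | Misjudged M T a s} (fun _ => M.r2) t) := by
  have hr1 := M.r1_nonneg
  have hr2 := M.r1_lt_r2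
  have hl1 := M.l1_nonneg
  have hl2 := M.l2_nonneg
  have hl := M.rates_le_one
  rw [arrivals_eq_add a 1 ht, arrivals_eq_add a 2 ht]
  have hsum := arrivals_add_add a (s := t + 1) (e := T)
  have hm : periodsLeft T t = ((T - t : ℕ) : ℝ) + 1 := by
    rw [Nat.cast_sub ht]; rfl
  have hnn : 0 ≤ Set.indicator {s | Misjudged M T a s} (fun _ => M.r2) t :=
    Set.indicator_nonneg (fun _ _ => hr1.trans hr2.le) _
  have hmis : Misjudged M T a t →
      Set.indicator {s | Misjudged M T a s} (fun _ => M.r2) t = M.r2 :=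
    fun h => Set.indicator_of_mem (s := {s | Misjudged M T a s}) h _
  have hdev : ∀ i : Fin 3, (i = 0 ∨ i = 2) → a t = 1 →
      M.l1 * ((T - t : ℕ) : ℝ) / 2 - 1 ≤
        (arrivals a i (t + 1) T : ℝ) - M.rate i * ((T - t : ℕ) : ℝ) → Misjudged M T a t :=
    fun i hi h1 h => ⟨h1, i, hi, h⟩
  have e0 : M.rate 0 = 1 - M.l1 - M.l2 := rfl
  have e2 : M.rate 2 = M.l2 := rfl
  generalize Set.indicator {s | Misjudged M T a s} (fun _ => M.r2) t = B at *
  have h00 := hdev 0 (Or.inl rfl)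
  have h22 := hdev 2 (Or.inr rfl)
  generalize Misjudged M T a t = Q at *
  generalize arrivals a 0 (t + 1) T = L0 at *
  generalize arrivals a 1 (t + 1) T = L1 at *
  generalize arrivals a 2 (t + 1) T = L2 at *
  clear hdev
  generalize a t = b at *
  obtain rfl | rfl | rfl : b = 0 ∨ b = 1 ∨ b = 2 := by fin_cases b <;> simp
  · simpa [step] using hnn
  · have hsumR : (L0 : ℝ) + L1 + L2 = ((T - t : ℕ) : ℝ) := by
      have : L0 + L1 + L2 = T - t := by omega
      exact_mod_cast this
    rw [e0] at h00
    rw [e2] at h22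
    by_cases h : 1 / 2 * M.l1 * periodsLeft T t < max ((C : ℝ) - M.l2 * periodsLeft T t) 0
    · have hC := one_le_of_free_upgrade T ht h
      have hs : step F T t (0, C) 1 u = (M.r1, (0, C - 1)) := by
        simp only [step]
        simp [h, -one_div]
      have hC' : 1 / 2 * M.l1 * periodsLeft T t < (C : ℝ) - M.l2 * periodsLeft T t := by
        rcases lt_max_iff.1 h with h | h
        · exact h
        · have : 0 ≤ 1 / 2 * M.l1 * periodsLeft T t := by
            have := one_le_periodsLeft T ht
            positivity
          linarith
      rw [hs]
      simp only [hindsight, if_true, show (1 : Fin 3) ≠ 2 by decide, if_false, Nat.zero_add]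
      by_cases hL : L2 < C
      · have i1 : min L2 (C - 1) = min L2 C := by omega
        have i2 : min (1 + L1) (C - L2) = 1 + min L1 (C - 1 - L2) := by omega
        rw [i1, i2]
        push_cast
        constructor <;> linarith
      · have i1 : min L2 (C - 1) = C - 1 := by omega
        have i2 : min (1 + L1) (C - L2) = 0 := by omega
        have i3 : min L1 (C - 1 - L2) = 0 := by omega
        have i4 : min L2 C = C := by omega
        have hLC : (C : ℝ) ≤ L2 := by exact_mod_cast not_lt.1 hL
        -- With `m = T - t`, acceptance means `C > (λ₂ + λ₁ / 2) (m + 1)`; with `L2 ≥ C` this puts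
        -- `L2` more than `λ₁ m / 2` above its mean `λ₂ m`.
        rw [hmis (h22 rfl (by rw [hm] at hC'; nlinarith)), i1, i2, i3, i4, Nat.cast_sub hC]
        push_cast
        constructor <;> linarith
    · have hs : step F T t (0, C) 1 u = (0, (0, C)) := by
        simp only [step]
        simp [h, -one_div]
      have hC' := (le_max_left _ _).trans (not_lt.1 h)
      rw [hs]
      simp only [hindsight, if_true, show (1 : Fin 3) ≠ 2 by decide, if_false, Nat.zero_add]
      by_cases hL : L1 + L2 < C
      · have i1 : min (1 + L1) (C - L2) = 1 + L1 := by omega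
        have i2 : min L1 (C - L2) = L1 := by omega
        have hLC : (L1 : ℝ) + L2 + 1 ≤ C := by exact_mod_cast hL
        -- Rejection means `C ≤ (λ₂ + λ₁ / 2) (m + 1)`. Since `L0 = m - L1 - L2 ≥ m - C + 1`, the
        -- excess of `L0` over `(1 - λ₁ - λ₂) m` is at least `λ₁ m / 2`.
        rw [hmis (h00 rfl (by rw [hm] at hC'; nlinarith)), i1, i2]
        push_cast
        constructor <;> linarith
      · have i1 : min (1 + L1) (C - L2) = min L1 (C - L2) := by omega
        rw [i1]
        constructor <;> linarith
  · simp only [step, hindsight, if_true, show (2 : Fin 3) ≠ 1 by decide, if_false, Nat.zero_add]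
    by_cases h : 1 ≤ C
    · have i1 : min (1 + L2) C = 1 + min L2 (C - 1) := by omega
      have i2 : C - (1 + L2) = C - 1 - L2 := by omega
      rw [if_pos h, i1, i2]
      push_cast
      constructor <;> linarith
    · obtain rfl : C = 0 := by omega
      simpa using hnn

/-- The one-period losses telescope, backwards from the empty segment at `T + 1`. -/
lemma hindsight_sub_policyRevenue_mem {s : ℕ} (h1 : tau F T c a x ≤ s) (h2 : s ≤ T + 1) :
    hindsight M (avail F T c a x s).2 (arrivals a 1 s T) (arrivals a 2 s T) -
      policyRevenue F T c a x s T ∈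
      Set.Icc 0 (∑ t ∈ Finset.Icc s T,
        Set.indicator {s | Misjudged M T a s} (fun _ => M.r2) t) := by
  induction h2 using Nat.decreasingInduction with
  | self => simp [arrivals_eq_zero_of_lt, hindsight, policyRevenue]
  | of_succ s hs ih =>
    have hsT : s ≤ T := by omega
    have ih := ih (by omega)
    have h0 := avail_fst_eq_zero_of_tau_le F T c a x h1 hsT
    have hav : avail F T c a x s = (0, (avail F T c a x s).2) := Prod.ext h0 rfl
    have hd := hindsight_sub_step_mem F T a (C := (avail F T c a x s).2) hsT (x s)
    rw [← hav, ← avail_succ F T c a x ((one_le_tau F T c a x).trans h1)] at hd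
    have hI : Finset.Icc s T = insert s (Finset.Icc (s + 1) T) := by
      ext k
      simp only [Finset.mem_Icc, Finset.mem_insert]
      omega
    have hp : policyRevenue F T c a x s T =
        (step F T s (avail F T c a x s) (a s) (x s)).1 + policyRevenue F T c a x (s + 1) T := by
      rw [policyRevenue, hI, Finset.sum_insert (by simp)]
      rfl
    rw [hp, hI, Finset.sum_insert (by simp)]
    constructor
    · linarith [hd.1, ih.1]
    · linarith [hd.2, ih.2]

lemma tauRegret_mem : tauRegret F T c a x ∈
    Set.Icc 0 (∑ t ∈ Finset.Icc 1 T,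
      Set.indicator {s | Misjudged M T a s} (fun _ => M.r2) t) := by
  unfold tauRegret
  rw [upperRevenue_tau]
  have h := hindsight_sub_policyRevenue_mem F T c a x le_rfl (tau_le F T c a x)
  -- Enlarging the sum from `[τ, T]` to `[1, T]` makes its index set deterministic.
  refine ⟨h.1, h.2.trans (Finset.sum_le_sum_of_subset_of_nonneg ?_ ?_)⟩
  · exact Finset.Icc_subset_Icc_left (one_le_tau F T c a x)
  · exact fun t _ _ => Set.indicator_nonneg (fun _ _ => M.r1_nonneg.trans M.r1_lt_r2.le) _

end Path
/-! ### Measurability -/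

section Measurability

variable {Ω : Type*} [MeasurableSpace Ω] (F : UpgradeCurve M) (T : ℕ) (c : ℕ × ℕ)
  {A : ℕ → Ω → Fin 3} {U : ℕ → Ω → ℝ}

/-- Availabilities and arrival range over a countable set, so only the dependence on the mark has to
be checked, and that is a single threshold. -/
lemma measurable_step (t : ℕ) :
    Measurable fun z : ((ℕ × ℕ) × Fin 3) × ℝ => step F T t z.1.1 z.1.2 z.2 := by
  refine measurable_from_prod_countable_right fun z => ?_
  change Measurable fun y => step F T t z.1 z.2 y
  unfold step
  have hx : MeasurableSet {x : ℝ | x ≤ F.f (upgradePrice F T t z.1.1 z.1.2)} :=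
    measurableSet_le measurable_id measurable_const
  exact .ite (.const _) (.ite (.const _) measurable_const measurable_const)
    (.ite (.const _) (.ite (.const _) (.ite (.const _) (.ite hx measurable_const measurable_const)
      measurable_const) (.ite (.const _) measurable_const measurable_const)) measurable_const)

lemma measurable_availAfter (hA : ∀ t, Measurable (A t)) (hU : ∀ t, Measurable (U t)) (k : ℕ) :
    Measurable fun ω => availAfter F T c (A · ω) (U · ω) k := by
  induction k with
  | zero => exact measurable_const
  | succ k ih =>
    exact ((measurable_step F T (k + 1)).comp
      ((ih.prodMk (hA (k + 1))).prodMk (hU (k + 1)))).snd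

lemma measurable_revenue (hA : ∀ t, Measurable (A t)) (hU : ∀ t, Measurable (U t)) (t : ℕ) :
    Measurable fun ω => revenue F T c (A · ω) (U · ω) t :=
  ((measurable_step F T t).comp
    (((measurable_availAfter F T c hA hU (t - 1)).prodMk (hA t)).prodMk (hU t))).fst

lemma measurable_arrivals (hA : ∀ t, Measurable (A t)) (i : Fin 3) (s e : ℕ) :
    Measurable fun ω => arrivals (A · ω) i s e := by
  simp only [arrivals, Finset.card_filter]
  refine Finset.measurable_sum _ fun t _ => ?_
  exact Measurable.ite (hA t (measurableSet_singleton i)) measurable_const measurable_const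

lemma measurable_tau (hA : ∀ t, Measurable (A t)) (hU : ∀ t, Measurable (U t)) :
    Measurable fun ω => tau F T c (A · ω) (U · ω) := by
  -- `τ` is a function of finitely many `ℕ × ℕ`-valued variables, hence of a variable in a countable
  -- discrete space.
  have h : Measurable fun ω => fun k : Fin (T + 1) => avail F T c (A · ω) (U · ω) k :=
    measurable_pi_lambda _ fun k => measurable_availAfter F T c hA hU _
  have h' : Measurable fun g : Fin (T + 1) → ℕ × ℕ =>
      sInf ({t : ℕ | 1 ≤ t ∧ ∃ ht : t ≤ T, (g ⟨t, Nat.lt_succ_of_le ht⟩).1 = 0} ∪ {T + 1}) :=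
    Measurable.of_discrete
  simpa only [tau, exists_prop, Function.comp_def] using h'.comp h

lemma measurable_upperRevenue (hA : ∀ t, Measurable (A t)) (hU : ∀ t, Measurable (U t))
    (s : ℕ) : Measurable fun ω => upperRevenue F T c (A · ω) (U · ω) s := by
  have h : Measurable fun z : (ℕ × ℕ) × ℕ × ℕ => upperHP F z.1.1 z.1.2 z.2.1 z.2.2 :=
    Measurable.of_discrete
  have h' : Measurable fun ω => (availAfter F T c (A · ω) (U · ω) (s - 1),
      arrivals (A · ω) 1 s T, arrivals (A · ω) 2 s T) :=
    (measurable_availAfter F T c hA hU (s - 1)).prodMk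
      ((measurable_arrivals hA 1 s T).prodMk (measurable_arrivals hA 2 s T))
  simpa only [upperRevenue, avail, Function.comp_def] using h.comp h'

lemma measurable_policyRevenue (hA : ∀ t, Measurable (A t)) (hU : ∀ t, Measurable (U t))
    (s e : ℕ) : Measurable fun ω => policyRevenue F T c (A · ω) (U · ω) s e := by
  unfold policyRevenue
  exact Finset.measurable_sum _ fun t _ => measurable_revenue F T c hA hU t

/-- A sequence of measurable functions, evaluated at a measurable random index, is measurable. -/
lemma measurable_eval_index {g : ℕ → Ω → ℝ} (hg : ∀ s, Measurable (g s)) {σ : Ω → ℕ}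
    (hσ : Measurable σ) : Measurable fun ω => g (σ ω) ω := by
  have h : Measurable fun z : ℕ × Ω => g z.1 z.2 := measurable_from_prod_countable_right hg
  exact h.comp (hσ.prodMk measurable_id)

lemma measurable_tauRegret (hA : ∀ t, Measurable (A t)) (hU : ∀ t, Measurable (U t)) :
    Measurable fun ω => tauRegret F T c (A · ω) (U · ω) :=
  measurable_eval_index
    (g := fun s ω => upperRevenue F T c (A · ω) (U · ω) s -
      policyRevenue F T c (A · ω) (U · ω) s T)
    (fun s => (measurable_upperRevenue F T c hA hU s).sub
      (measurable_policyRevenue F T c hA hU s T))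
    (measurable_tau F T c hA hU)

lemma measurableSet_misjudged (hA : ∀ t, Measurable (A t)) (t : ℕ) :
    MeasurableSet {ω | Misjudged M T (A · ω) t} := by
  have h : Measurable fun ω => (A t ω, fun i => arrivals (A · ω) i (t + 1) T) :=
    (hA t).prodMk (measurable_pi_lambda _ fun i => measurable_arrivals hA i _ _)
  exact h (MeasurableSet.of_discrete (s := {z : Fin 3 × (Fin 3 → ℕ) | z.1 = 1 ∧
    ∃ i : Fin 3, (i = 0 ∨ i = 2) ∧ M.l1 * ((T - t : ℕ) : ℝ) / 2 - 1 ≤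
      (z.2 i : ℝ) - M.rate i * ((T - t : ℕ) : ℝ)}))

end Measurability

/-! ### Concentration of the arrivals -/

lemma Market.rate_nonneg (M : Market) (i : Fin 3) : 0 ≤ M.rate i := by
  have := M.l1_nonneg
  have := M.l2_nonneg
  have := M.rates_le_one
  fin_cases i <;> simp [Market.rate] <;> linarith

section Concentration

variable {Ω : Type*} [MeasurableSpace Ω] {P : Measure Ω} [IsProbabilityMeasure P]
  {A : ℕ → Ω → Fin 3} {U : ℕ → Ω → ℝ}

lemma hasSubgaussianMGF_arrivals (h : IsRequestProcess M P A U) (i : Fin 3) (s e : ℕ) :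
    HasSubgaussianMGF
      (fun ω => (arrivals (A · ω) i s e : ℝ) - M.rate i * ((e + 1 - s : ℕ) : ℝ))
      (((e + 1 - s : ℕ) : NNReal) * (1 / 4)) P := by
  have hind : iIndepFun (fun t ω => (if A t ω = i then (1 : ℝ) else 0) - M.rate i) P :=
    h.indep_periods.comp (fun _ z => (if z.1 = i then (1 : ℝ) else 0) - M.rate i) fun _ =>
      (Measurable.ite (measurable_fst (measurableSet_singleton i)) measurable_const
        measurable_const).sub_const _
  have hsub : ∀ t, HasSubgaussianMGF
      (fun ω => (if A t ω = i then (1 : ℝ) else 0) - M.rate i) (1 / 4) P := by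
    intro t
    have hmeas : MeasurableSet {ω | A t ω = i} := h.measurable_A t (measurableSet_singleton i)
    have hint : ∫ ω, (if A t ω = i then (1 : ℝ) else 0) ∂P = M.rate i := by
      have := integral_indicator_one (μ := P) hmeas
      rw [measureReal_def, h.law_A, ENNReal.toReal_ofReal (M.rate_nonneg i)] at this
      rw [← this]
      refine integral_congr_ae (ae_of_all _ fun ω => ?_)
      by_cases hω : A t ω = i <;> simp [hω]
    have hsg := hasSubgaussianMGF_of_mem_Icc (μ := P) (a := 0) (b := 1)
      (X := fun ω => if A t ω = i then (1 : ℝ) else 0)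
      (Measurable.ite hmeas measurable_const measurable_const).aemeasurable
      (ae_of_all _ fun ω => by by_cases hω : A t ω = i <;> simp [hω])
    rw [hint] at hsg
    -- Hoeffding's lemma on an interval of length `1` gives the variance proxy `(1 / 2) ^ 2 = 1 /
    -- 4`.
    convert hsg using 1
    ext
    norm_num
  have := HasSubgaussianMGF.sum_of_iIndepFun hind (s := Finset.Icc s e) fun t _ => hsub t
  convert this using 1
  · ext ω
    simp [arrivals, Finset.sum_sub_distrib, mul_comm]
  · simp

lemma measureReal_misjudged_le (h : IsRequestProcess M P A U) (T t : ℕ) :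
    P.real {ω | Misjudged M T (A · ω) t} ≤
      2 * Real.exp M.l1 * Real.exp (-(3 / 8 * M.l1 ^ 2)) ^ (T - t) := by
  have key : ∀ i : Fin 3, P.real {ω | M.l1 * ((T - t : ℕ) : ℝ) / 2 - 1 ≤
      (arrivals (A · ω) i (t + 1) T : ℝ) - M.rate i * ((T - t : ℕ) : ℝ)} ≤
      Real.exp M.l1 * Real.exp (-(3 / 8 * M.l1 ^ 2)) ^ (T - t) := by
    intro i
    have hsg := hasSubgaussianMGF_arrivals h i (t + 1) T
    rw [Nat.add_sub_add_right] at hsg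
    generalize T - t = m at hsg ⊢
    -- Chernoff's bound with parameter `λ₁` has exponent `-λ₁ (λ₁ m / 2 - 1) + (m / 4) λ₁² / 2 = λ₁
    -- - 3 / 8 λ₁² m`.
    refine (measure_ge_le_exp_mul_mgf _ M.l1_nonneg (hsg.integrable_exp_mul _)).trans ?_
    refine (mul_le_mul_of_nonneg_left (hsg.mgf_le _) (Real.exp_nonneg _)).trans (le_of_eq ?_)
    rw [← Real.exp_nat_mul, ← Real.exp_add, ← Real.exp_add]
    congr 1
    push_cast
    ring
  have hsub : {ω | Misjudged M T (A · ω) t} ⊆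
      {ω | M.l1 * ((T - t : ℕ) : ℝ) / 2 - 1 ≤
        (arrivals (A · ω) 0 (t + 1) T : ℝ) - M.rate 0 * ((T - t : ℕ) : ℝ)} ∪
      {ω | M.l1 * ((T - t : ℕ) : ℝ) / 2 - 1 ≤
        (arrivals (A · ω) 2 (t + 1) T : ℝ) - M.rate 2 * ((T - t : ℕ) : ℝ)} := by
    rintro ω ⟨-, i, rfl | rfl, hi⟩
    · exact Or.inl hi
    · exact Or.inr hi
  calc P.real {ω | Misjudged M T (A · ω) t} ≤ _ := measureReal_mono hsub
    _ ≤ _ := measureReal_union_le _ _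
    _ ≤ _ := add_le_add (key 0) (key 2)
    _ = _ := by ring

-- For `λ₁ = 0` the geometric ratio is `1` and the tail bound cannot be summed, but almost surely no
-- type-1 request arrives.
omit [IsProbabilityMeasure P] in
lemma measureReal_misjudged_eq_zero (h : IsRequestProcess M P A U) (hl : M.l1 = 0) (T t : ℕ) :
    P.real {ω | Misjudged M T (A · ω) t} = 0 := by
  have h0 : P {ω | A t ω = 1} = 0 := by
    rw [h.law_A, show M.rate 1 = M.l1 from rfl, hl, ENNReal.ofReal_zero]
  rw [measureReal_def, measure_mono_null (fun ω hω => hω.1) h0, ENNReal.toReal_zero]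

lemma sum_measureReal_misjudged_le (h : IsRequestProcess M P A U) (T : ℕ) :
    ∑ t ∈ Finset.Icc 1 T, P.real {ω | Misjudged M T (A · ω) t} ≤
      2 * Real.exp M.l1 * (1 - Real.exp (-(3 / 8 * M.l1 ^ 2)))⁻¹ := by
  rcases M.l1_nonneg.eq_or_lt with hl | hl
  -- Here the right-hand side is `0` as well, because `(1 - exp 0)⁻¹ = 0⁻¹ = 0`.
  · simp [measureReal_misjudged_eq_zero h hl.symm, ← hl]
  set q := Real.exp (-(3 / 8 * M.l1 ^ 2)) with hq
  have hq0 : 0 ≤ q := (Real.exp_pos _).le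
  have hq1 : q < 1 := by
    rw [hq, Real.exp_lt_one_iff]
    have : 0 < M.l1 ^ 2 := by positivity
    linarith
  calc ∑ t ∈ Finset.Icc 1 T, P.real {ω | Misjudged M T (A · ω) t}
      ≤ ∑ t ∈ Finset.Icc 1 T, 2 * Real.exp M.l1 * q ^ (T - t) :=
        Finset.sum_le_sum fun t _ => measureReal_misjudged_le h T t
    _ = 2 * Real.exp M.l1 * ∑ k ∈ Finset.range T, q ^ k := by
        rw [← Finset.mul_sum]
        congr 1
        refine Finset.sum_nbij' (fun t => T - t) (fun k => T - k) ?_ ?_ ?_ ?_ fun _ _ => rfl <;>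
          simp only [Finset.mem_Icc, Finset.mem_range] <;> omega
    _ ≤ 2 * Real.exp M.l1 * (1 - q)⁻¹ := by
        have := (summable_geometric_of_lt_one hq0 hq1).sum_le_tsum (Finset.range T)
          fun k _ => pow_nonneg hq0 k
        rw [tsum_geometric_of_lt_one hq0 hq1] at this
        exact mul_le_mul_of_nonneg_left this (by positivity)

lemma integrable_tauRegret (h : IsRequestProcess M P A U) (F : UpgradeCurve M) (T : ℕ)
    (c : ℕ × ℕ) : Integrable (fun ω => tauRegret F T c (A · ω) (U · ω)) P := by
  refine Integrable.of_bound
    (measurable_tauRegret F T c h.measurable_A h.measurable_U).aestronglyMeasurable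
    (∑ _t ∈ Finset.Icc 1 T, M.r2) (ae_of_all _ fun ω => ?_)
  have hr := tauRegret_mem F T c (A · ω) (U · ω)
  rw [Real.norm_of_nonneg hr.1]
  exact hr.2.trans (Finset.sum_le_sum fun t _ =>
    Set.indicator_le_self' (fun _ _ => M.r1_nonneg.trans M.r1_lt_r2.le) t)

lemma abs_integral_tauRegret_le (h : IsRequestProcess M P A U) (F : UpgradeCurve M) (T : ℕ)
    (c : ℕ × ℕ) : |∫ ω, tauRegret F T c (A · ω) (U · ω) ∂P| ≤
      M.r2 * (2 * Real.exp M.l1 * (1 - Real.exp (-(3 / 8 * M.l1 ^ 2)))⁻¹) := by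
  have hr := fun ω => tauRegret_mem F T c (A · ω) (U · ω)
  have hr2 : 0 ≤ M.r2 := M.r1_nonneg.trans M.r1_lt_r2.le
  have hm := fun t => measurableSet_misjudged (M := M) T h.measurable_A t
  have hint : ∀ t, Integrable ({ω | Misjudged M T (A · ω) t}.indicator fun _ => M.r2) P :=
    fun t => (integrable_const _).indicator (hm t)
  -- The benchmark dominates the policy on every path, so the absolute value can be dropped.
  rw [abs_of_nonneg (integral_nonneg fun ω => (hr ω).1)]
  calc ∫ ω, tauRegret F T c (A · ω) (U · ω) ∂P
      ≤ ∫ ω, ∑ t ∈ Finset.Icc 1 T,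
          {ω | Misjudged M T (A · ω) t}.indicator (fun _ => M.r2) ω ∂P :=
        integral_mono (integrable_tauRegret h F T c)
          (integrable_finsetSum _ fun t _ => hint t) fun ω => (hr ω).2
    _ = M.r2 * ∑ t ∈ Finset.Icc 1 T, P.real {ω | Misjudged M T (A · ω) t} := by
        rw [integral_finsetSum _ fun t _ => hint t, Finset.mul_sum]
        refine Finset.sum_congr rfl fun t _ => ?_
        rw [integral_indicator_const _ (hm t), smul_eq_mul, mul_comm]
    _ ≤ _ := mul_le_mul_of_nonneg_left (sum_measureReal_misjudged_le h T) hr2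

end Concentration

end Upgrading

theorem proposition1 (M : Upgrading.Market) :
    ∃ K : ℝ, ∀ (F : Upgrading.UpgradeCurve M) (T c1 c2 : ℕ)
      (Ω : Type*) [MeasurableSpace Ω] (P : MeasureTheory.Measure Ω)
      [MeasureTheory.IsProbabilityMeasure P] (A : ℕ → Ω → Fin 3) (U : ℕ → Ω → ℝ),
      Upgrading.IsRequestProcess M P A U →
      -- from `τ` on, DynUp-2 runs a single-leg problem on the type-2 resource with fares `r₁`, `r₂`
      (∀ ω, ∀ t ∈ Finset.Icc (Upgrading.tau F T (c1, c2) (A · ω) (U · ω)) T,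
        (Upgrading.avail F T (c1, c2) (A · ω) (U · ω) t).1 = 0 ∧
        ∃ y : ℕ, y ≤ (if A t ω = 0 then 0 else 1) ∧
          y ≤ (Upgrading.avail F T (c1, c2) (A · ω) (U · ω) t).2 ∧
          Upgrading.revenue F T (c1, c2) (A · ω) (U · ω) t = y * M.fare (A t ω) ∧
          Upgrading.avail F T (c1, c2) (A · ω) (U · ω) (t + 1) =
            (0, (Upgrading.avail F T (c1, c2) (A · ω) (U · ω) t).2 - y)) ∧
      -- and the benchmark is the hindsight optimum of that single-leg problem
      (∀ ω, IsGreatest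
        (Upgrading.singleLegRevenues M
          (Upgrading.avail F T (c1, c2) (A · ω) (U · ω)
            (Upgrading.tau F T (c1, c2) (A · ω) (U · ω))).2
          (Upgrading.arrivals (A · ω) 1 (Upgrading.tau F T (c1, c2) (A · ω) (U · ω)) T)
          (Upgrading.arrivals (A · ω) 2 (Upgrading.tau F T (c1, c2) (A · ω) (U · ω)) T))
        (Upgrading.upperRevenue F T (c1, c2) (A · ω) (U · ω)
          (Upgrading.tau F T (c1, c2) (A · ω) (U · ω)))) ∧
      -- the expected regret on `[τ, T]` is `O(1)`
      MeasureTheory.Integrable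
        (fun ω => Upgrading.tauRegret F T (c1, c2) (A · ω) (U · ω)) P ∧
      |∫ ω, Upgrading.tauRegret F T (c1, c2) (A · ω) (U · ω) ∂P| ≤ K := by
  refine ⟨M.r2 * (2 * Real.exp M.l1 * (1 - Real.exp (-(3 / 8 * M.l1 ^ 2)))⁻¹), ?_⟩
  intro F T c1 c2 Ω _ P _ A U h
  refine ⟨fun ω t ht => ?_, fun ω => ?_, Upgrading.integrable_tauRegret h F T (c1, c2),
    Upgrading.abs_integral_tauRegret_le h F T (c1, c2)⟩
  · rw [Finset.mem_Icc] at ht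
    have h0 := Upgrading.avail_fst_eq_zero_of_tau_le F T (c1, c2) (A · ω) (U · ω) ht.1 ht.2
    obtain ⟨y, hy1, hy2, hy3, hy4⟩ := Upgrading.exists_step_of_fst_eq_zero F T
      (C := (Upgrading.avail F T (c1, c2) (A · ω) (U · ω) t).2) ht.2 (A t ω) (U t ω)
    rw [← h0, Prod.mk.eta] at hy3 hy4
    refine ⟨h0, y, hy1, hy2, hy3, ?_⟩
    rw [Upgrading.avail_succ F T (c1, c2) (A · ω) (U · ω)
      ((Upgrading.one_le_tau F T (c1, c2) (A · ω) (U · ω)).trans ht.1), hy4, h0]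
  · rw [Upgrading.upperRevenue_tau]
    exact Upgrading.isGreatest_hindsight _ _ _ _
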